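/- Let $\mathcal{H}^{(k)}(n,p)$ denote the random $k$-uniform hypergraph with vertex set $[n]=\{1,\dots,n\}$ in which every $k$-element subset of $[n]$ is an edge independently with probability $p$. A hypergraph $H=(V,E)$ is *connected* if its shadow graph (the graph on $V$ in which two distinct vertices are adjacent iff some edge of $H$ contains both) is connected, and a *component* of $H$ is a maximal connected subgraph of $H$. For a colouring $\chi:E\to[r]$ of the edges, a *monochromatic component* is a component of one of the hypergraphs $(V,\chi^{-1}(i))$, $i\in[r]$. Let $\mathrm{mc}(H,\chi)$ be the largest number of vertices of a monochromatic component under $\chi$, and let $\mathrm{mc}_r(H)=\min_{\chi:E\to[r]}\mathrm{mc}(H,\chi)$. Let $k\ge 3$ be an integer, let $\alpha>0$ be a real number, and let $p=p(n)\in[0,1]$ be such that $p\,n^{k-1}\to\infty$ as $n\to\infty$. Then, with probability tending to $1$ as $n\to\infty$, 1. $\mathrm{mc}_k\left(\mathcal{H}^{(k)}(n,p)\right)\ge (1-\alpha)\,n$, and 2. $\mathrm{mc}_{k+1}\left(\mathcal{H}^{(k)}(n,p)\right)\ge \left(\frac{k}{k+1}-\alpha\right)n$. -/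

import Mathlib

open MeasureTheory ProbabilityTheory Filter Topology

namespace Hypergraph

variable {α : Type*}

/-- `H'` is a subgraph of `H`: its vertices and its edges are vertices and edges of `H`. -/
def IsSubgraph (H' H : Hypergraph α) : Prop :=
  H'.vertexSet ⊆ H.vertexSet ∧ H'.edgeSet ⊆ H.edgeSet

/-- The shadow graph of `H`: the graph on the vertex set of `H` in which two distinct vertices
are joined iff some edge of `H` contains both. -/
def shadow (H : Hypergraph α) : SimpleGraph H.vertexSet where
  Adj x y := x ≠ y ∧ H.Adj (x : α) (y : α)
  symm := ⟨fun _ _ h => ⟨h.1.symm, h.2.symm⟩⟩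
  loopless := ⟨fun _ h => h.1 rfl⟩

/-- A hypergraph is connected if its shadow graph is (in particular it has a vertex). -/
def IsConnected (H : Hypergraph α) : Prop := H.shadow.Connected

/-- `C` is a component of `H`: a maximal connected subgraph of `H`. -/
structure IsComponent (C H : Hypergraph α) : Prop where
  isSubgraph : C.IsSubgraph H
  isConnected : C.IsConnected
  eq_of_isSubgraph : ∀ D : Hypergraph α,
    D.IsSubgraph H → D.IsConnected → C.IsSubgraph D → D = C

/-- The hypergraph formed by the edges of colour `i`, on all the vertices of `H`. -/
def colorClass (H : Hypergraph α) {r : ℕ} (χ : H.edgeSet → Fin r) (i : Fin r) :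
    Hypergraph α where
  vertexSet := H.vertexSet
  edgeSet := {e | ∃ h : e ∈ H.edgeSet, χ ⟨e, h⟩ = i}
  subset_vertexSet_of_mem_edgeSet' := fun _ he =>
    H.subset_vertexSet_of_mem_edgeSet' he.1

/-- `C` is a monochromatic component of `H` under the edge colouring `χ`. -/
def IsMonoComponent (C H : Hypergraph α) {r : ℕ} (χ : H.edgeSet → Fin r) : Prop :=
  ∃ i : Fin r, C.IsComponent (H.colorClass χ i)

/-- The order of the largest monochromatic component of `H` under `χ` (for hypergraphs with
finitely many vertices). -/
noncomputable def mcColoring (H : Hypergraph α) {r : ℕ} (χ : H.edgeSet → Fin r) : ℕ :=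
  sSup {m | ∃ C : Hypergraph α, C.IsMonoComponent H χ ∧ C.vertexSet.ncard = m}

/-- The minimum of `mcColoring H χ` over all colourings `χ` of the edges of `H` with colours from
an `r`-element set. -/
noncomputable def mc (r : ℕ) (H : Hypergraph α) : ℕ :=
  ⨅ χ : H.edgeSet → Fin r, H.mcColoring χ

/-- The hypergraph whose vertices are all elements of `α` and whose edge set is `E`. -/
def ofEdgeSet (E : Set (Set α)) : Hypergraph α where
  vertexSet := Set.univ
  edgeSet := E
  subset_vertexSet_of_mem_edgeSet' := fun _ _ => Set.subset_univ _

/-- There are finitely many hypergraphs on an `n`-element type; every set of them is an event. -/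
instance instMeasurableSpaceFin (n : ℕ) : MeasurableSpace (Hypergraph (Fin n)) := ⊤

/-- The law of the random hypergraph `H^(k)(n, p)`: the vertex set is the `n`-element set `Fin n`,
and every `k`-element set of vertices is an edge independently with probability `p`. -/
noncomputable def random (k n : ℕ) (p : unitInterval) : Measure (Hypergraph (Fin n)) :=
  (setBernoulli {e : Set (Fin n) | e.ncard = k} p).map ofEdgeSet

lemma measurable_ofEdgeSet (n : ℕ) :
    Measurable (ofEdgeSet : Set (Set (Fin n)) → Hypergraph (Fin n)) :=
  .of_discrete

instance (k n : ℕ) (p : unitInterval) : IsProbabilityMeasure (random k n p) :=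
  Measure.isProbabilityMeasure_map (measurable_ofEdgeSet n).aemeasurable

end Hypergraph

/-! With high probability any `k` vertex sets of proportion `γ` have a transversal edge; the rest is
deterministic. Given an `r`-colouring, merge the components of each colour into boundedly many
classes (`exists_coarsening`). Each vertex then has a vector of `r` labels, and all but few vertices
carry a popular vector. Suppose popular `x`, `y` agree in `r - D` coordinates. A transversal edge of
their two atoms and the `r - D` sets `{h i ≠ x i}` lies in no class of any colour, so `r - D + 2 >
k` (`card_ne_add_lt`).

For `r = k` popular vectors are pairwise at Hamming distance at most 1, hence share a coordinate
(`exists_coord_const`), and one class contains almost everything. For `r = k + 1` the distance is at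
most 2. If no coordinate is shared, the vectors lie in a ball of radius 1 about some `w`
(`exists_center`), so the sets `{h i ≠ w i}` are essentially disjoint; one has at most about `n / (k
+ 1)` vertices, and its complement is a class. -/

/-! ### Coarsening partitions; vectors at small pairwise Hamming distance. -/

/-- A partition given by labels `g` whose classes have at most `s` elements can be coarsened to one
with at most `M` classes, each of at most `s + m` elements. -/
lemma exists_coarsening {V ι : Type*} [Fintype V] [Finite ι] (g : V → ι) {s m M : ℕ}
    (hm : Fintype.card V < m * M)
    (hs : ∀ v, {u | g u = g v}.ncard ≤ s) :
    ∃ h : V → Fin M, (∀ u v, g u = g v → h u = h v) ∧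
      ∀ a, {v | h v = a}.ncard ≤ s + m := by
  classical
  have hm0 : 0 < m := Nat.pos_of_ne_zero fun h => by simp [h] at hm
  obtain ⟨N, ⟨e⟩⟩ := Finite.exists_equiv_fin ι
  let c : V → ℕ := fun v => e (g v)
  have hc : ∀ u v, c u = c v ↔ g u = g v := fun u v => by
    simp [c, Fin.val_inj]
  -- With the classes laid out in order, `pos v` is where the class of `v` starts; classes are
  -- grouped by the window of length `m` containing their start.
  let pos : V → ℕ := fun v => {u | c u < c v}.ncard
  have hpos : ∀ v, pos v / m < M := fun v => by
    rw [Nat.div_lt_iff_lt_mul hm0, mul_comm]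
    refine lt_of_le_of_lt ?_ hm
    rw [← Nat.card_eq_fintype_card]
    exact Set.ncard_le_card _
  refine ⟨fun v => ⟨pos v / m, hpos v⟩, fun u v huv => ?_, fun a => ?_⟩
  · have : c u = c v := (hc u v).2 huv
    simp [pos, this]
  · set S : Set V := {v | (⟨pos v / m, hpos v⟩ : Fin M) = a} with hS
    rcases S.eq_empty_or_nonempty with h0 | h0
    · simp [h0]
    obtain ⟨v0, hv0, hmin⟩ := Set.exists_min_image S c S.toFinite h0
    obtain ⟨v1, hv1, hmax⟩ := Set.exists_max_image S c S.toFinite h0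
    have hsub : S ⊆ {u | g u = g v1} ∪ ({u | c u < c v1} \ {u | c u < c v0}) := by
      intro u hu
      rcases (hmax u hu).lt_or_eq with h | h
      · exact Or.inr ⟨h, not_lt.2 (hmin u hu)⟩
      · exact Or.inl ((hc _ _).1 h)
    have hle : {u | c u < c v0} ⊆ {u | c u < c v1} := fun u hu =>
      lt_of_lt_of_le hu (hmax v0 hv0)
    have hdiff : ({u | c u < c v1} \ {u | c u < c v0}).ncard ≤ m := by
      rw [Set.ncard_sdiff hle (Set.toFinite _)]
      have h1 : pos v1 / m = pos v0 / m := by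
        have := hv0.trans hv1.symm
        exact (congrArg Fin.val this).symm
      change pos v1 - pos v0 ≤ m
      have e1 := Nat.div_add_mod (pos v1) m
      have e0 := Nat.div_add_mod (pos v0) m
      have l1 := Nat.mod_lt (pos v1) hm0
      rw [h1] at e1
      omega
    calc S.ncard ≤ _ := Set.ncard_le_ncard hsub (Set.toFinite _)
      _ ≤ _ := Set.ncard_union_le _ _
      _ ≤ s + m := Nat.add_le_add (hs v1) hdiff

/-- Vectors with at least two coordinates, no two of which differ in two coordinates, agree in some
coordinate. -/
lemma exists_coord_const {r : ℕ} {β : Type*} (hr : 2 ≤ r) {L : Set (Fin r → β)}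
    (hL : ∀ x ∈ L, ∀ y ∈ L, ∀ i j, i ≠ j → x i ≠ y i → x j = y j) {w : Fin r → β} (hw : w ∈ L) :
    ∃ i, ∀ x ∈ L, x i = w i := by
  by_contra! H
  have : Nontrivial (Fin r) := Fin.nontrivial_iff_two_le.2 hr
  obtain ⟨y, hy, hj⟩ := H ⟨0, by omega⟩
  obtain ⟨i, hi⟩ := exists_ne (⟨0, by omega⟩ : Fin r)
  obtain ⟨x, hx, hxi⟩ := H i
  have h1 := hL x hx w hw i _ hi hxi
  have h2 := hL y hy w hw _ i hi.symm hj
  exact hxi ((hL x hx y hy _ i hi.symm (by rw [h1]; exact hj.symm)).trans h2)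

/-- Vectors with at least four coordinates, no two of which differ in three coordinates and which do
not agree in any coordinate, lie within Hamming distance one of a common centre. -/
lemma exists_center {r : ℕ} {β : Type*} (hr : 4 ≤ r) {L : Set (Fin r → β)}
    (hL : ∀ x ∈ L, ∀ y ∈ L, ∀ i j l, i ≠ j → i ≠ l → j ≠ l → x i ≠ y i → x j ≠ y j → x l = y l)
    (hne : L.Nonempty) (hc : ∀ i, ∀ a, ∃ x ∈ L, x i ≠ a) :
    ∃ w : Fin r → β, ∀ x ∈ L, ∀ i j, i ≠ j → x i ≠ w i → x j = w j := by
  classical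
  -- Without a pair at distance 2, `exists_coord_const` would give a shared coordinate.
  obtain ⟨x, hx, y, hy, a, b, hab, hxa, hxb⟩ :
      ∃ x ∈ L, ∃ y ∈ L, ∃ a b, a ≠ b ∧ x a ≠ y a ∧ x b ≠ y b := by
    by_contra! H
    obtain ⟨w, hw⟩ := hne
    obtain ⟨i, hi⟩ := exists_coord_const (by omega) (fun x hx y hy i j => H x hx y hy i j) hw
    obtain ⟨z, hz, hzi⟩ := hc i (w i)
    exact hzi (hi z hz)
  obtain ⟨c, hc'⟩ : ∃ c, c ∉ ({a, b} : Finset (Fin r)) := by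
    by_contra! H
    have := Finset.card_le_card (fun c _ => H c : (Finset.univ : Finset (Fin r)) ⊆ _)
    have h2 := Finset.card_le_two (a := a) (b := b)
    simp at this
    omega
  obtain ⟨d, hd'⟩ : ∃ d, d ∉ ({a, b, c} : Finset (Fin r)) := by
    by_contra! H
    have := Finset.card_le_card (fun c _ => H c : (Finset.univ : Finset (Fin r)) ⊆ _)
    have h2 := Finset.card_le_three (a := a) (b := b) (c := c)
    simp at this
    omega
  simp only [Finset.mem_insert, Finset.mem_singleton, not_or] at hc' hd'
  obtain ⟨hca, hcb⟩ := hc'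
  obtain ⟨hda, hdb, hdc⟩ := hd'
  have hxy : ∀ l, l ≠ a → l ≠ b → x l = y l := fun l h1 h2 =>
    hL x hx y hy a b l hab h1.symm h2.symm hxa hxb
  -- A vector leaving `x` at some `j` outside `a`, `b` already differs there from both `x` and `y`,
  -- so on `a`, `b` it must mix them, one value from each.
  have key : ∀ z ∈ L, ∀ j, j ≠ a → j ≠ b → z j ≠ x j →
      ((z a = x a ∧ z b = y b) ∨ (z a = y a ∧ z b = x b)) ∧
        ∀ l, l ≠ a → l ≠ b → l ≠ j → z l = x l := by
    intro z hz j hja hjb hzj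
    have h1 := hL z hz x hx j a b hja hjb hab hzj
    have hzj' : z j ≠ y j := by rw [← hxy j hja hjb]; exact hzj
    have h2 := hL z hz y hy j a b hja hjb hab hzj'
    have h3 : z a = x a → z b = y b := fun h => h2 (by rw [h]; exact hxa)
    have h4 : z a ≠ x a → z a = y a := fun h => by
      by_contra h'
      exact hxb ((h1 h).symm.trans (h2 h'))
    refine ⟨?_, fun l hla hlb hlj => ?_⟩
    · by_cases h : z a = x a
      · exact Or.inl ⟨h, h3 h⟩
      · exact Or.inr ⟨h4 h, h1 h⟩
    · by_cases h : z a = x a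
      · exact hL z hz x hx j b l hjb hlj.symm hlb.symm hzj (by rw [h3 h]; exact hxb.symm)
      · exact hL z hz x hx j a l hja hlj.symm hla.symm hzj h
  -- The centre agrees with `x` off one of the coordinates `a`, `b`, where it agrees with `y`.
  obtain ⟨zc, hzc, hzc'⟩ := hc c (x c)
  obtain ⟨zd, hzd, hzd'⟩ := hc d (x d)
  obtain ⟨tc, oc⟩ := key zc hzc c hca hcb hzc'
  obtain ⟨td, od⟩ := key zd hzd d hda hdb hzd'
  have same : ∀ z ∈ L, ∀ z' ∈ L, ∀ j, j ≠ a → j ≠ b → z j ≠ z' j → z a ≠ z' a → z b ≠ z' b →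
      False := fun z hz z' hz' j hja hjb h1 h2 h3 => h3 (hL z hz z' hz' j a b hja hjb hab h1 h2)
  -- The two mixtures differ at both `a` and `b`, so `zc` and `zd` must use the same one, which
  -- becomes the centre. Two outside coordinates are needed: a vector leaving `x` at `l` is compared
  -- with whichever of `zc`, `zd` leaves it elsewhere. In three coordinates the even-weight binary
  -- vectors have no centre.
  have hcd : zc c ≠ zd c := by rw [od c hca hcb (Ne.symm hdc)]; exact hzc'
  have fin : ∀ p q, zc a = p → zc b = q → zd a = p → zd b = q →
      (∀ z : Fin r → β, (z a = x a ∧ z b = y b) ∨ (z a = y a ∧ z b = x b) → (z a = p ∧ z b = q) ∨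
        (z a ≠ p ∧ z b ≠ q)) →
      ∃ w : Fin r → β, ∀ x ∈ L, ∀ i j, i ≠ j → x i ≠ w i → x j = w j := by
    intro p q hp hq hp' hq' hpq
    refine ⟨fun i => if i = a then p else if i = b then q else x i, fun u hu => ?_⟩
    have hu' : (∃ l, l ≠ a ∧ l ≠ b ∧ u l ≠ x l ∧ u a = p ∧ u b = q ∧
        ∀ l', l' ≠ a → l' ≠ b → l' ≠ l → u l' = x l') ∨
        ((∀ l, l ≠ a → l ≠ b → u l = x l) ∧ (u a = p ∨ u b = q)) := by
      by_cases h : ∀ l, l ≠ a → l ≠ b → u l = x l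
      · refine Or.inr ⟨h, ?_⟩
        by_contra! h'
        exact same u hu zc hzc c hca hcb (by rw [h c hca hcb]; exact hzc'.symm)
          (by rw [hp]; exact h'.1) (by rw [hq]; exact h'.2)
      · push Not at h
        obtain ⟨l, hla, hlb, hl⟩ := h
        obtain ⟨t, o⟩ := key u hu l hla hlb hl
        rcases hpq u t with h | h
        · exact Or.inl ⟨l, hla, hlb, hl, h.1, h.2, o⟩
        · exfalso
          by_cases hlc : l = c
          · subst hlc
            exact same u hu zd hzd l hla hlb (by rw [od l hla hlb (Ne.symm hdc)]; exact hl)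
              (by rw [hp']; exact h.1) (by rw [hq']; exact h.2)
          · exact same u hu zc hzc c hca hcb (by rw [o c hca hcb (Ne.symm hlc)]; exact hzc'.symm)
              (by rw [hp]; exact h.1) (by rw [hq]; exact h.2)
    intro i j hij hi
    grind
  rcases tc with tc | tc <;> rcases td with td | td
  · exact fin _ _ tc.1 tc.2 td.1 td.2 (by grind)
  · exact (same zc hzc zd hzd c hca hcb hcd (by grind) (by grind)).elim
  · exact (same zc hzc zd hzd c hca hcb hcd (by grind) (by grind)).elim
  · exact fin _ _ tc.1 tc.2 td.1 td.2 (by grind)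

/-! ### Components as reachability classes of the shadow graph. -/

namespace Hypergraph

variable {V : Type*}

/-- The vertices in the same component of the shadow graph as `v`. -/
def reachSet (K : Hypergraph V) (v : V) : Set V :=
  {u | ∃ (hv : v ∈ K.vertexSet) (hu : u ∈ K.vertexSet), K.shadow.Reachable ⟨v, hv⟩ ⟨u, hu⟩}

lemma mem_reachSet_self {K : Hypergraph V} {v : V} (hv : v ∈ K.vertexSet) : v ∈ K.reachSet v :=
  ⟨hv, hv, .rfl⟩

lemma reachSet_subset_of_reachable {K : Hypergraph V} {u v : V} (h : u ∈ K.reachSet v) :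
    K.reachSet u ⊆ K.reachSet v := by
  rintro w ⟨hu, hw, hr⟩
  obtain ⟨hv, hu', hr'⟩ := h
  exact ⟨hv, hw, hr'.trans hr⟩

lemma mem_reachSet_of_mem_edge {K : Hypergraph V} {e : Set V} (he : e ∈ K.edgeSet) {u v : V}
    (hu : u ∈ e) (hv : v ∈ e) : u ∈ K.reachSet v := by
  refine ⟨K.subset_vertexSet_of_mem_edgeSet' he hv, K.subset_vertexSet_of_mem_edgeSet' he hu, ?_⟩
  by_cases h : v = u
  · subst h; rfl
  · exact SimpleGraph.Adj.reachable ⟨fun h' => h (congrArg Subtype.val h'), e, he, hv, hu⟩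

lemma reachSet_eq_of_mem_edge {K : Hypergraph V} {e : Set V} (he : e ∈ K.edgeSet) {u v : V}
    (hu : u ∈ e) (hv : v ∈ e) : K.reachSet u = K.reachSet v :=
  (reachSet_subset_of_reachable (mem_reachSet_of_mem_edge he hu hv)).antisymm
    (reachSet_subset_of_reachable (mem_reachSet_of_mem_edge he hv hu))

/-- The subgraph of `K` induced by `K.reachSet v`. -/
def componentAt (K : Hypergraph V) (v : V) : Hypergraph V where
  vertexSet := K.reachSet v
  edgeSet := {e | e ∈ K.edgeSet ∧ e ⊆ K.reachSet v}
  subset_vertexSet_of_mem_edgeSet' := fun _ he => he.2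

/-- Every edge met along a shadow path from `v` lies wholly inside `K.reachSet v`, so the path
survives in the induced subgraph. -/
lemma isConnected_componentAt {K : Hypergraph V} {v : V} (hv : v ∈ K.vertexSet) :
    (K.componentAt v).IsConnected := by
  have hvv : v ∈ (K.componentAt v).vertexSet := mem_reachSet_self hv
  have key : ∀ u : K.vertexSet, Relation.ReflTransGen K.shadow.Adj ⟨v, hv⟩ u →
      ∃ h : (u : V) ∈ (K.componentAt v).vertexSet,
        (K.componentAt v).shadow.Reachable ⟨v, hvv⟩ ⟨u, h⟩ := by
    intro u hu
    induction hu with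
    | refl => exact ⟨hvv, .rfl⟩
    | @tail a b _ hab ih =>
      obtain ⟨ha, hr⟩ := ih
      obtain ⟨hne, e, he, hae, hbe⟩ := hab
      have hsub : e ⊆ K.reachSet v := fun x hx =>
        reachSet_subset_of_reachable ha (mem_reachSet_of_mem_edge he hx hae)
      refine ⟨hsub hbe, hr.trans (SimpleGraph.Adj.reachable ⟨fun h => hne ?_, e, ⟨he, hsub⟩,
        hae, hbe⟩)⟩
      exact Subtype.ext (Subtype.mk_eq_mk.1 h)
  have key' : ∀ u : (K.componentAt v).vertexSet,
      (K.componentAt v).shadow.Reachable ⟨v, hvv⟩ u := by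
    rintro ⟨u, hv', hu, hr⟩
    exact (key ⟨u, hu⟩ ((SimpleGraph.reachable_iff_reflTransGen _ _).1 hr)).2
  have : Nonempty (K.componentAt v).vertexSet := ⟨⟨v, hvv⟩⟩
  exact ⟨fun a b => (key' a).symm.trans (key' b)⟩

lemma isComponent_componentAt {K : Hypergraph V} {v : V} (hv : v ∈ K.vertexSet) :
    (K.componentAt v).IsComponent K where
  isSubgraph := ⟨fun _ hu => hu.2.1, fun _ he => he.1⟩
  isConnected := isConnected_componentAt hv
  eq_of_isSubgraph := by
    intro D hDK hD hCD
    have hvD : v ∈ D.vertexSet := hCD.1 (mem_reachSet_self hv)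
    let φ : D.shadow →g K.shadow :=
      { toFun := fun x => ⟨x, hDK.1 x.2⟩
        map_rel' := by
          rintro a b ⟨hne, e, he, h⟩
          exact ⟨fun h' => hne (Subtype.ext (Subtype.mk_eq_mk.1 h')), e, hDK.2 he, h⟩ }
    have hV : D.vertexSet ⊆ K.reachSet v := fun u hu =>
      ⟨hv, hDK.1 hu, (hD.preconnected ⟨v, hvD⟩ ⟨u, hu⟩).map φ⟩
    refine Hypergraph.ext (hV.antisymm hCD.1) (Set.Subset.antisymm (fun e he => ?_) hCD.2)
    exact ⟨hDK.2 he, (D.subset_vertexSet_of_mem_edgeSet' he).trans hV⟩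

/-- An optimal colouring yields, for every colour, a partition of the vertices into classes with at
most `H.mc r` vertices, such that every edge lies in a class of its colour. -/
lemma exists_labelling [Finite V] (H : Hypergraph V) (hV : H.vertexSet = Set.univ) {r : ℕ}
    (hr : 0 < r) :
    ∃ g : Fin r → V → Set V, (∀ i v, {u | g i u = g i v}.ncard ≤ H.mc r) ∧
      ∀ e ∈ H.edgeSet, ∃ i, ∀ u ∈ e, ∀ v ∈ e, g i u = g i v := by
  have : Nonempty (Fin r) := ⟨⟨0, hr⟩⟩
  obtain ⟨χ, hχ⟩ : H.mc r ∈ Set.range fun χ : H.edgeSet → Fin r => H.mcColoring χ :=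
    Nat.sInf_mem (Set.range_nonempty _)
  have hmem : ∀ i v, v ∈ (H.colorClass χ i).vertexSet := fun i v => by
    change v ∈ H.vertexSet
    simp [hV]
  refine ⟨fun i => (H.colorClass χ i).reachSet, fun i v => ?_, fun e he => ⟨χ ⟨e, he⟩, ?_⟩⟩
  · have h1 : {u | (H.colorClass χ i).reachSet u = (H.colorClass χ i).reachSet v} ⊆
        (H.colorClass χ i).reachSet v := by
      intro u hu
      rw [← show (H.colorClass χ i).reachSet u = (H.colorClass χ i).reachSet v from hu]
      exact mem_reachSet_self (hmem i u)
    refine (Set.ncard_le_ncard h1 (Set.toFinite _)).trans ?_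
    rw [← hχ]
    -- Boundedness matters: `sSup` of an unbounded set of naturals is 0.
    refine le_csSup ⟨Nat.card V, ?_⟩ ⟨_, ⟨i, isComponent_componentAt (hmem i v)⟩, rfl⟩
    rintro _ ⟨C, _, rfl⟩
    exact Set.ncard_le_card _
  · intro u hu v hv
    exact reachSet_eq_of_mem_edge (K := H.colorClass χ _) ⟨he, rfl⟩ hu hv

end Hypergraph

/-! ### The deterministic bounds from transversal edges. -/

namespace Hypergraph

/-- Any `k` sets containing at least a proportion `γ` of the vertices have a transversal which is an
edge of `H`. -/
def HasTransversalEdges {n : ℕ} (k : ℕ) (γ : ℝ) (H : Hypergraph (Fin n)) : Prop :=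
  ∀ A : Fin k → Set (Fin n), (∀ i, γ * n ≤ (A i).ncard) →
    ∃ f : Fin k → Fin n, (∀ i, f i ∈ A i) ∧ Set.range f ∈ H.edgeSet

lemma HasTransversalEdges.mono {n k : ℕ} {γ γ' : ℝ} {H : Hypergraph (Fin n)} (h : γ ≤ γ')
    (hH : H.HasTransversalEdges k γ) : H.HasTransversalEdges k γ' :=
  fun A hA => hH A fun i => (by gcongr : γ * n ≤ γ' * n).trans (hA i)

/-- If every edge lies in a class of one of `r` partitions, all of whose classes have a large
complement, then two large atoms of the partitions differ in few coordinates. -/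
lemma HasTransversalEdges.card_ne_add_lt {n k r M : ℕ} {γ : ℝ} (hγ : γ ≤ 1)
    {H : Hypergraph (Fin n)} (hH : H.HasTransversalEdges k γ) {h : Fin r → Fin n → Fin M}
    (hedge : ∀ e ∈ H.edgeSet, ∃ i, ∀ u ∈ e, ∀ v ∈ e, h i u = h i v)
    (hcompl : ∀ i a, γ * n ≤ ({v | h i v ≠ a} : Set (Fin n)).ncard) {x y : Fin r → Fin M}
    (hx : γ * n ≤ ({v | (fun i => h i v) = x} : Set (Fin n)).ncard)
    (hy : γ * n ≤ ({v | (fun i => h i v) = y} : Set (Fin n)).ncard) :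
    k + (Finset.univ.filter fun i => x i ≠ y i).card < r + 2 := by
  by_contra! hk
  have hcard : (Finset.univ.filter fun i => x i ≠ y i).card +
      (Finset.univ.filter fun i => x i = y i).card = r := by
    have := Finset.card_filter_add_card_filter_not (s := (Finset.univ : Finset (Fin r)))
      (fun i => x i = y i)
    simp at this ⊢
    omega
  obtain ⟨ι⟩ : Nonempty ({i // x i = y i} ⊕ Bool ↪ Fin k) := by
    apply Function.Embedding.nonempty_of_card_le
    rw [Fintype.card_sum, Fintype.card_bool, Fintype.card_fin, Fintype.card_subtype]
    omega
  let B : {i // x i = y i} ⊕ Bool → Set (Fin n) :=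
    Sum.elim (fun i => {v | h i v ≠ x i})
      (fun b => if b then {v | (fun i => h i v) = x} else {v | (fun i => h i v) = y})
  have hB : ∀ s, γ * n ≤ (B s).ncard := by
    rintro (i | b)
    · exact hcompl _ _
    · cases b <;> simpa [B]
  -- Spare indices receive the whole vertex set, which is large enough because `γ ≤ 1`.
  obtain ⟨f, hf, hfe⟩ := hH (Function.extend ι B fun _ => Set.univ) (fun j => by
    by_cases hj : ∃ s, ι s = j
    · obtain ⟨s, rfl⟩ := hj
      rw [ι.injective.extend_apply]
      exact hB s
    · rw [Function.extend_apply' _ _ _ hj, Set.ncard_univ, Nat.card_eq_fintype_card,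
        Fintype.card_fin]
      exact mul_le_of_le_one_left (Nat.cast_nonneg _) hγ)
  have hf' : ∀ s, f (ι s) ∈ B s := fun s => by
    have := hf (ι s)
    rwa [ι.injective.extend_apply] at this
  obtain ⟨i, hi⟩ := hedge _ hfe
  have hfx : h i (f (ι (Sum.inr true))) = x i := congrFun (hf' (Sum.inr true)) i
  have hfy : h i (f (ι (Sum.inr false))) = y i := congrFun (hf' (Sum.inr false)) i
  by_cases hxy : x i = y i
  · have h1 : h i (f (ι (Sum.inl ⟨i, hxy⟩))) ≠ x i := hf' (Sum.inl ⟨i, hxy⟩)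
    exact h1 ((hi _ ⟨_, rfl⟩ _ ⟨_, rfl⟩).trans hfx)
  · exact hxy (by rw [← hfx, ← hfy]; exact hi _ ⟨_, rfl⟩ _ ⟨_, rfl⟩)

/-- At most `t` elements per value of `f` lie in a fibre with fewer than `t` elements. -/
lemma ncard_small_fibers_le {V β : Type*} [Fintype V] [Fintype β] (f : V → β) {t : ℝ} (ht : 0 ≤ t) :
    ({v | ¬ t ≤ (f ⁻¹' {f v}).ncard} : Set V).ncard ≤ Fintype.card β * t := by
  classical
  have h1 : ({v | ¬ t ≤ (f ⁻¹' {f v}).ncard} : Set V).ncard =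
      (Finset.univ.filter fun v => ¬ t ≤ (f ⁻¹' {f v}).ncard).card := by
    rw [← Set.ncard_coe_finset]; simp
  rw [h1, Finset.card_eq_sum_card_fiberwise (f := f) (t := Finset.univ) (by simp), Nat.cast_sum]
  calc _ ≤ ∑ _b : β, t := Finset.sum_le_sum fun b _ => ?_
    _ = _ := by simp
  by_cases hb : t ≤ (f ⁻¹' {b}).ncard
  · rw [Finset.filter_eq_empty_iff.2]
    · simpa
    · rintro v hv rfl
      exact (Finset.mem_filter.1 hv).2 hb
  · refine le_trans ?_ (not_le.1 hb).le
    rw [← Set.ncard_coe_finset, Nat.cast_le]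
    exact Set.ncard_le_ncard (fun v hv => (Finset.mem_filter.1 hv).2) (Set.toFinite _)

/-- If `H` has a colouring with small monochromatic components, then there are `r` partitions of
bounded size with small classes, together with a set of vectors carrying almost all vertices,
any two of which differ in few coordinates. -/
lemma exists_large_atoms (k : ℕ) {r : ℕ} (hr : 0 < r) {α c : ℝ} (hα : 0 < α) (hc : c ≤ 1) :
    ∃ M : ℕ, ∃ γ : ℝ, 0 < γ ∧ ∃ n₀ : ℕ, ∀ n ≥ n₀, ∀ H : Hypergraph (Fin n),
      H.vertexSet = Set.univ → H.HasTransversalEdges k γ → (H.mc r : ℝ) < (c - α) * n →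
      ∃ h : Fin r → Fin n → Fin M,
        (∀ i a, (({v | h i v = a} : Set (Fin n)).ncard : ℝ) ≤ (c - α / 2) * n) ∧
        ∃ L : Set (Fin r → Fin M), L.Nonempty ∧
          (({v | (fun i => h i v) ∉ L} : Set (Fin n)).ncard : ℝ) ≤ α / 4 * n ∧
          ∀ x ∈ L, ∀ y ∈ L, k + (Finset.univ.filter fun i => x i ≠ y i).card < r + 2 := by
  obtain ⟨M, hM⟩ := exists_nat_gt (4 / α)
  have hM0 : (0 : ℝ) < M := (by positivity : 0 < 4 / α).trans hM
  have hM0' : 0 < M := by exact_mod_cast hM0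
  have hM1 : (1 : ℝ) ≤ (M : ℝ) ^ r := one_le_pow₀ (by exact_mod_cast hM0')
  -- `M > 4 / α` keeps the coarsening loss `n / M + 1` below `α / 2 * n`; this `γ` makes the at most
  -- `M ^ r` small atoms cover at most `α / 4 * n` vertices.
  refine ⟨M, min 1 (α / (4 * M ^ r)), by positivity, M, fun n hn H hV hH hmc => ?_⟩
  set γ : ℝ := min 1 (α / (4 * M ^ r)) with hγ
  have hγ0 : 0 ≤ γ := by positivity
  have hγM : M ^ r * γ ≤ α / 4 := by
    calc (M : ℝ) ^ r * γ ≤ M ^ r * (α / (4 * M ^ r)) := by gcongr; exact min_le_right _ _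
      _ = α / 4 := by field_simp
  have hγα : γ ≤ α / 4 := (le_mul_of_one_le_left hγ0 hM1).trans hγM
  have hn0 : (0 : ℝ) < n := by exact_mod_cast hM0'.trans_le hn
  have hMn : (M : ℝ) ≤ n := by exact_mod_cast hn
  have hαM : 4 < α * M := by rwa [div_lt_iff₀' hα] at hM
  have hαn : 4 < α * n := hαM.trans_le (by gcongr)
  -- Together with `c ≤ 1` this gives `α < 1`, so the small atoms cannot cover everything and `L` is
  -- nonempty.
  have hαc : α < c := by
    by_contra! hcon
    have : (c - α) * n ≤ 0 := mul_nonpos_of_nonpos_of_nonneg (by linarith) hn0.le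
    have h0 : (0 : ℝ) ≤ H.mc r := Nat.cast_nonneg _
    linarith
  obtain ⟨g, hg, hge⟩ := H.exists_labelling hV hr
  have hcoarse := fun i => exists_coarsening (m := n / M + 1) (M := M) (g i)
    (by rw [Fintype.card_fin, mul_comm]; exact Nat.lt_mul_div_succ n hM0') (hg i)
  choose h hgh hh using hcoarse
  have hm : ((n / M + 1 : ℕ) : ℝ) ≤ α / 2 * n := by
    have h1 : ((n / M : ℕ) : ℝ) ≤ n / M := Nat.cast_div_le
    have h2 : (n : ℝ) / M ≤ α / 4 * n := by
      rw [div_le_iff₀ hM0]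
      nlinarith
    push_cast
    linarith
  have hclass : ∀ i a, (({v | h i v = a} : Set (Fin n)).ncard : ℝ) ≤ (c - α / 2) * n := by
    intro i a
    have : (({v | h i v = a} : Set (Fin n)).ncard : ℝ) ≤ (H.mc r : ℝ) + (n / M + 1 : ℕ) := by
      exact_mod_cast hh i a
    linarith
  have hsmall := ncard_small_fibers_le (fun v i => h i v) (t := γ * n) (by positivity)
  have hsmall' : (Fintype.card (Fin r → Fin M) : ℝ) * (γ * n) ≤ α / 4 * n := by
    rw [← mul_assoc]
    gcongr
    simpa using hγM
  refine ⟨h, hclass, {x | γ * n ≤ ((fun v i => h i v) ⁻¹' {x}).ncard}, ?_, hsmall.trans hsmall', ?_⟩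
  · by_contra hcon
    rw [Set.not_nonempty_iff_eq_empty] at hcon
    have hlt := hsmall.trans hsmall'
    have huniv : ({v | ¬ γ * n ≤ ((fun v i => h i v) ⁻¹' {fun i => h i v}).ncard} : Set (Fin n)) =
        Set.univ := by
      refine Set.eq_univ_of_forall fun v hv => ?_
      have : (fun i => h i v) ∈ {x | γ * n ≤ (((fun v i => h i v) ⁻¹' {x}).ncard : ℝ)} := hv
      rw [hcon] at this
      exact this
    rw [huniv, Set.ncard_univ, Nat.card_eq_fintype_card, Fintype.card_fin] at hlt
    nlinarith
  · intro x hx y hy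
    refine hH.card_ne_add_lt (min_le_left _ _) (h := h) (fun e he => ?_) (fun i a => ?_) hx hy
    · obtain ⟨i, hi⟩ := hge e he
      exact ⟨i, fun u hu v hv => hgh i u v (hi u hu v hv)⟩
    · have h1 := Set.ncard_add_ncard_compl ({v | h i v = a} : Set (Fin n))
      rw [Nat.card_eq_fintype_card, Fintype.card_fin] at h1
      have h2 : (({v | h i v = a} : Set (Fin n)).ncard : ℝ) +
        ({v | h i v ≠ a} : Set (Fin n)).ncard = n := by exact_mod_cast h1
      have := hclass i a
      nlinarith

lemma le_ncard_add_ncard {n : ℕ} (S T : Set (Fin n)) (h : ∀ v, v ∈ S ∨ v ∈ T) :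
    (n : ℝ) ≤ S.ncard + T.ncard := by
  have h1 := Set.ncard_union_le S T
  rw [Set.eq_univ_of_forall (s := S ∪ T) h, Set.ncard_univ, Nat.card_eq_fintype_card,
    Fintype.card_fin] at h1
  exact_mod_cast h1

theorem exists_le_mc_self {k : ℕ} (hk : 2 ≤ k) {α : ℝ} (hα : 0 < α) :
    ∃ γ : ℝ, 0 < γ ∧ ∃ n₀ : ℕ, ∀ n ≥ n₀, ∀ H : Hypergraph (Fin n),
      H.vertexSet = Set.univ → H.HasTransversalEdges k γ → (1 - α) * n ≤ (H.mc k : ℝ) := by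
  obtain ⟨M, γ, hγ, n₀, hn₀⟩ := exists_large_atoms k (r := k) (by omega) hα le_rfl
  refine ⟨γ, hγ, n₀ + 1, fun n hn H hV hH => ?_⟩
  by_contra! hmc
  have hn0 : (0 : ℝ) < n := by exact_mod_cast (by omega : 0 < n)
  obtain ⟨h, hclass, L, ⟨w, hw⟩, hsmall, hL⟩ := hn₀ n (by omega) H hV hH hmc
  obtain ⟨i, hi⟩ := exists_coord_const hk (L := L) (fun x hx y hy i j hij hxi => by
    by_contra hxj
    have h1 : ({i, j} : Finset (Fin k)) ⊆ Finset.univ.filter fun i => x i ≠ y i := by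
      simp [Finset.insert_subset_iff, hxi, hxj]
    have h2 := Finset.card_le_card h1
    rw [Finset.card_pair hij] at h2
    have := hL x hx y hy
    omega) hw
  have h1 := le_ncard_add_ncard {v | h i v = w i} {v | (fun i => h i v) ∉ L} fun v => by
    by_cases hv : (fun i => h i v) ∈ L
    · exact Or.inl (hi _ hv)
    · exact Or.inr hv
  have h2 := hclass i (w i)
  nlinarith

theorem exists_le_mc_succ {k : ℕ} (hk : 3 ≤ k) {α : ℝ} (hα : 0 < α) :
    ∃ γ : ℝ, 0 < γ ∧ ∃ n₀ : ℕ, ∀ n ≥ n₀, ∀ H : Hypergraph (Fin n),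
      H.vertexSet = Set.univ → H.HasTransversalEdges k γ →
        ((k : ℝ) / (k + 1) - α) * n ≤ (H.mc (k + 1) : ℝ) := by
  classical
  have hc1 : (k : ℝ) / (k + 1) ≤ 1 := by rw [div_le_one (by positivity)]; linarith
  obtain ⟨M, γ, hγ, n₀, hn₀⟩ := exists_large_atoms k (r := k + 1) (by omega) hα hc1
  refine ⟨γ, hγ, n₀ + 1, fun n hn H hV hH => ?_⟩
  by_contra! hmc
  have hn0 : (0 : ℝ) < n := by exact_mod_cast (by omega : 0 < n)
  obtain ⟨h, hclass, L, hLne, hsmall, hL⟩ := hn₀ n (by omega) H hV hH hmc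
  obtain ⟨w, hw⟩ := exists_center (r := k + 1) (by omega) (L := L)
    (fun x hx y hy i j l hij hil hjl hxi hxj => by
      by_contra hxl
      have h1 : ({i, j, l} : Finset (Fin (k + 1))) ⊆ Finset.univ.filter fun i => x i ≠ y i := by
        simp [Finset.insert_subset_iff, hxi, hxj, hxl]
      have h2 := Finset.card_le_card h1
      rw [Finset.card_eq_three.2 ⟨i, j, l, hij, hil, hjl, rfl⟩] at h2
      have := hL x hx y hy
      omega) hLne (fun i a => by
    by_contra! hcon
    have h1 := le_ncard_add_ncard {v | h i v = a} {v | (fun i => h i v) ∉ L} fun v => by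
      by_cases hv : (fun i => h i v) ∈ L
      · exact Or.inl (hcon _ hv)
      · exact Or.inr hv
    have h2 := hclass i a
    nlinarith)
  let S : Fin (k + 1) → Finset (Fin n) := fun i =>
    Finset.univ.filter fun v => (fun i => h i v) ∈ L ∧ h i v ≠ w i
  have hdisj : ∀ i ∈ (Finset.univ : Finset (Fin (k + 1))), ∀ j ∈ Finset.univ, i ≠ j →
      Disjoint (S i) (S j) := by
    intro i _ j _ hij
    rw [Finset.disjoint_left]
    intro v hvi hvj
    simp only [S, Finset.mem_filter, Finset.mem_univ, true_and] at hvi hvj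
    exact hvj.2 (hw _ hvi.1 i j hij hvi.2)
  have hsum : ∑ i, ((S i).card : ℝ) ≤ n := by
    have := Finset.card_le_univ (Finset.univ.biUnion S)
    rw [Finset.card_biUnion hdisj, Fintype.card_fin] at this
    exact_mod_cast this
  -- Each class misses at least `(1 - c + α / 2) * n` vertices with `c = k / (k + 1)`, of which at
  -- most `α / 4 * n` have vectors outside `L`. Summed over `k + 1` disjoint sets this exceeds `n`.
  have hS : ∀ i, (1 - (k : ℝ) / (k + 1) + α / 4) * n ≤ (S i).card := by
    intro i
    have h1 := le_ncard_add_ncard ({v | h i v = w i} ∪ {v | (fun i => h i v) ∉ L}) (S i)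
      fun v => by
        simp only [Set.mem_union, Set.mem_ofPred_eq, S, Finset.coe_filter, Finset.mem_univ, true_and]
        tauto
    have h2 : ((({v | h i v = w i} ∪ {v | (fun i => h i v) ∉ L}) : Set (Fin n)).ncard : ℝ) ≤
        ({v | h i v = w i} : Set (Fin n)).ncard +
          ({v | (fun i => h i v) ∉ L} : Set (Fin n)).ncard := by
      exact_mod_cast Set.ncard_union_le _ _
    rw [Set.ncard_coe_finset] at h1
    have h3 := hclass i (w i)
    linarith
  have hsum' := (Finset.sum_le_sum fun i (_ : i ∈ Finset.univ) => hS i).trans hsum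
  rw [Finset.sum_const, Finset.card_univ, Fintype.card_fin, nsmul_eq_mul] at hsum'
  have hk' : ((k : ℝ) + 1) * (1 - k / (k + 1) + α / 4) = 1 + (k + 1) * (α / 4) := by
    field_simp
    ring
  push_cast at hsum'
  rw [← mul_assoc, hk'] at hsum'
  have : 0 < ((k : ℝ) + 1) * (α / 4) * n := by positivity
  linarith

end Hypergraph

/-! ### Transversal edges in the random hypergraph. -/

lemma setBernoulli_disjoint {ι : Type*} [Countable ι] {u : Set ι} (p : unitInterval)
    {T : Finset ι} (hT : ∀ e ∈ T, e ∈ u) :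
    setBernoulli u p {s | ∀ e ∈ T, e ∉ s} =
      (unitInterval.toNNReal (unitInterval.symm p) : ENNReal) ^ T.card := by
  have h1 : (fun q : ι → Prop => {i | q i}) ⁻¹' {s | ∀ e ∈ T, e ∉ s} =
      Set.pi T fun _ => ({False} : Set Prop) := by
    ext q
    simp [Set.mem_pi]
  rw [setBernoulli_apply', h1, Measure.infinitePi_pi _ (fun _ _ => MeasurableSet.of_discrete),
    Finset.prod_congr rfl (g := fun _ =>
      (unitInterval.toNNReal (unitInterval.symm p) : ENNReal)), Finset.prod_const]
  intro e he
  simp [hT e he]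

/-- `k` sets of size at least `k * m` contain pairwise disjoint subsets of size `m`. -/
lemma exists_injective_prod {V : Type*} [Finite V] {k m : ℕ} {A : Fin k → Set V}
    (hA : ∀ i, k * m ≤ (A i).ncard) :
    ∃ F : Fin k × Fin m → V, Function.Injective F ∧ ∀ q, F q ∈ A q.1 := by
  classical
  have := Fintype.ofFinite V
  -- Hall's condition is immediate: each `A i` alone is at least as large as the whole index set.
  obtain ⟨F, hF, hFA⟩ := (Finset.all_card_le_biUnion_card_iff_exists_injective
    (fun q : Fin k × Fin m => (A q.1).toFinset)).1 (fun s => by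
      rcases s.eq_empty_or_nonempty with rfl | ⟨q, hq⟩
      · simp
      · calc s.card ≤ k * m := by simpa using Finset.card_le_univ s
          _ ≤ (A q.1).ncard := hA _
          _ = (A q.1).toFinset.card := Set.ncard_eq_toFinset_card' _
          _ ≤ _ := Finset.card_le_card
            (Finset.subset_biUnion_of_mem (fun q : Fin k × Fin m => (A q.1).toFinset) hq))
  exact ⟨F, hF, fun q => by simpa using hFA q⟩

/-- Choose one vertex from each of `k` disjoint blocks of size `m`; disjointness lets the resulting
set determine the choice. -/
lemma exists_transversals {V : Type*} [Finite V] {k m : ℕ} {A : Fin k → Set V}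
    (hA : ∀ i, k * m ≤ (A i).ncard) :
    ∃ T : Finset (Set V), T.card = m ^ k ∧ ∀ e ∈ T, e.ncard = k ∧
      ∃ f : Fin k → V, (∀ i, f i ∈ A i) ∧ Set.range f = e := by
  classical
  obtain ⟨F, hF, hFA⟩ := exists_injective_prod hA
  refine ⟨Finset.univ.image fun g : Fin k → Fin m => Set.range fun i => F (i, g i), ?_, ?_⟩
  · rw [Finset.card_image_of_injective]
    · simp
    · intro g g' h
      funext i
      have h1 : F (i, g i) ∈ Set.range fun i => F (i, g' i) := by
        rw [← show (Set.range fun i => F (i, g i)) = Set.range fun i => F (i, g' i) from h]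
        exact ⟨i, rfl⟩
      obtain ⟨i', hi'⟩ := h1
      have h2 := hF hi'
      simp only [Prod.mk.injEq] at h2
      obtain ⟨rfl, h2⟩ := h2
      exact h2.symm
  · intro e he
    obtain ⟨g, -, rfl⟩ := Finset.mem_image.1 he
    refine ⟨?_, fun i => F (i, g i), fun i => hFA (i, g i), rfl⟩
    rw [← Set.image_univ, Set.ncard_image_of_injective, Set.ncard_univ]
    · simp
    · intro i j hij
      exact (Prod.mk.inj (hF hij)).1

namespace Hypergraph

/-- Union bound over the `(2 ^ n) ^ k` families `A`; a bad family forces `m ^ k` given edges to be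
absent. -/
lemma random_not_hasTransversalEdges_le {k n m : ℕ} {γ : ℝ} (p : unitInterval)
    (hm : (k * m : ℝ) ≤ γ * n) :
    random k n p {H | ¬ H.HasTransversalEdges k γ} ≤
      ENNReal.ofReal (((2 : ℝ) ^ n) ^ k * Real.exp (-(p * m ^ k))) := by
  classical
  rw [random, Measure.map_apply (measurable_ofEdgeSet n) MeasurableSet.of_discrete]
  let bad : (Fin k → Set (Fin n)) → Set (Set (Set (Fin n))) := fun A =>
    {E | (∀ i, γ * n ≤ (A i).ncard) ∧
      ∀ f : Fin k → Fin n, (∀ i, f i ∈ A i) → Set.range f ∉ E}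
  have hsub : (ofEdgeSet : Set (Set (Fin n)) → _) ⁻¹' {H | ¬ H.HasTransversalEdges k γ} ⊆
      ⋃ A, bad A := by
    intro E hE
    have hE' : ¬ (ofEdgeSet E).HasTransversalEdges k γ := hE
    unfold HasTransversalEdges at hE'
    push Not at hE'
    obtain ⟨A, hA, hf⟩ := hE'
    exact Set.mem_iUnion.2 ⟨A, hA, hf⟩
  have hbad : ∀ A, setBernoulli {e : Set (Fin n) | e.ncard = k} p (bad A) ≤
      ENNReal.ofReal (Real.exp (-(p * m ^ k))) := by
    intro A
    by_cases hA : ∀ i, γ * n ≤ (A i).ncard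
    · obtain ⟨T, hTc, hT⟩ := exists_transversals (m := m) (A := A) fun i => by
        exact_mod_cast hm.trans (hA i)
      have h1 : bad A ⊆ {E | ∀ e ∈ T, e ∉ E} := by
        rintro E ⟨-, hE⟩ e he
        obtain ⟨-, f, hf, rfl⟩ := hT e he
        exact hE f hf
      refine (measure_mono h1).trans ?_
      rw [setBernoulli_disjoint (u := {e : Set (Fin n) | e.ncard = k}) p fun e he => (hT e he).1, hTc]
      have h2 : (unitInterval.toNNReal (unitInterval.symm p) : ENNReal) =
          ENNReal.ofReal (1 - p) := by
        rw [ENNReal.ofReal, ENNReal.coe_inj]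
        ext
        simp [p.2.2]
      rw [h2, ← ENNReal.ofReal_pow (by linarith [p.2.2])]
      apply ENNReal.ofReal_le_ofReal
      calc (1 - (p : ℝ)) ^ (m ^ k) ≤ Real.exp (-p) ^ (m ^ k) := by
            gcongr
            · linarith [p.2.2]
            · exact Real.one_sub_le_exp_neg _
        _ = _ := by
            rw [← Real.exp_nat_mul]
            push_cast
            ring_nf
    · have : bad A = ∅ := Set.eq_empty_of_forall_notMem fun E hE => hA hE.1
      simp [this]
  calc _ ≤ _ := measure_mono hsub
    _ ≤ _ := measure_iUnion_fintype_le _ _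
    _ ≤ ∑ _A : Fin k → Set (Fin n), ENNReal.ofReal (Real.exp (-(p * m ^ k))) :=
        Finset.sum_le_sum fun A _ => hbad A
    _ = _ := by
        rw [Finset.sum_const, nsmul_eq_mul, ENNReal.ofReal_mul (by positivity)]
        congr 1
        simp [ENNReal.ofReal_pow]

lemma tendsto_random_hasTransversalEdges {k : ℕ} (hk : 1 ≤ k) {γ : ℝ} (hγ : 0 < γ)
    (p : ℕ → unitInterval)
    (hp : Tendsto (fun n : ℕ => (p n : ℝ) * (n : ℝ) ^ (k - 1)) atTop atTop) :
    Tendsto (fun n => random k n (p n) {H | H.HasTransversalEdges k γ}) atTop (𝓝 1) := by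
  have hk0 : (0 : ℝ) < k := by exact_mod_cast hk
  set δ : ℝ := γ / (2 * k) with hδ
  have hδ0 : 0 < δ := by positivity
  have hexp : Tendsto (fun n : ℕ => ENNReal.ofReal (Real.exp (-(n : ℝ)))) atTop (𝓝 0) := by
    rw [← ENNReal.ofReal_zero]
    exact (ENNReal.continuous_ofReal.tendsto 0).comp
      (Real.tendsto_exp_neg_atTop_nhds_zero.comp tendsto_natCast_atTop_atTop)
  have hbad : Tendsto (fun n => random k n (p n) {H | ¬ H.HasTransversalEdges k γ}) atTop
      (𝓝 0) := by
    refine tendsto_of_tendsto_of_tendsto_of_le_of_le' tendsto_const_nhds hexp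
      (Eventually.of_forall fun _ => zero_le) ?_
    -- The first threshold makes the exponent at least `(k + 1) * n`, beating `2 ^ (n * k) ≤ exp (k
    -- * n)` by `exp (-n)`. The second gives `δ * n ≥ 1`, so rounding `2 * δ * n` down leaves at
    -- least `δ * n`.
    filter_upwards [hp.eventually_ge_atTop ((k + 1) / δ ^ k),
      tendsto_natCast_atTop_atTop.eventually_ge_atTop (1 / δ)] with n hn hn'
    have h0 : (0 : ℝ) ≤ γ * n / k := by positivity
    have hm : (k * (⌊γ * n / k⌋₊ : ℕ) : ℝ) ≤ γ * n := by
      have := Nat.floor_le h0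
      rwa [le_div_iff₀' hk0] at this
    refine (random_not_hasTransversalEdges_le (p n) hm).trans (ENNReal.ofReal_le_ofReal ?_)
    have hfl : δ * n ≤ (⌊γ * n / k⌋₊ : ℕ) := by
      have h1 := Nat.lt_floor_add_one (γ * n / k)
      have h2 : γ * n / k = 2 * (δ * n) := by rw [hδ]; field_simp
      rw [div_le_iff₀' hδ0] at hn'
      linarith
    have hmain : (k + 1 : ℝ) * n ≤ p n * (⌊γ * n / k⌋₊ : ℕ) ^ k := by
      rw [div_le_iff₀ (by positivity)] at hn
      calc (k + 1 : ℝ) * n ≤ (p n * n ^ (k - 1) * δ ^ k) * n := by gcongr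
        _ = p n * (δ * n) ^ k := by
            obtain ⟨j, rfl⟩ : ∃ j, k = j + 1 := ⟨k - 1, by omega⟩
            simp only [Nat.add_sub_cancel]
            ring
        _ ≤ _ := by
            gcongr
            exact (p n).2.1
    have h2 : ((2 : ℝ) ^ n) ^ k ≤ Real.exp (k * n) := by
      calc ((2 : ℝ) ^ n) ^ k ≤ (Real.exp 1 ^ n) ^ k := by
            gcongr
            linarith [Real.add_one_le_exp (1 : ℝ)]
        _ = _ := by
            rw [← pow_mul, ← Real.exp_nat_mul]
            push_cast
            ring_nf
    calc _ ≤ Real.exp (k * n) * Real.exp (-((k + 1 : ℝ) * n)) := by gcongr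
      _ = _ := by rw [← Real.exp_add]; ring_nf
  have hcompl : ∀ n, random k n (p n) {H | H.HasTransversalEdges k γ} =
      1 - random k n (p n) {H | ¬ H.HasTransversalEdges k γ} := fun n => by
    rw [← prob_compl_eq_one_sub MeasurableSet.of_discrete]
    congr 1
    ext H
    simp
  simp_rw [hcompl]
  simpa using ENNReal.Tendsto.sub tendsto_const_nhds hbad (Or.inl ENNReal.one_ne_top)

lemma ae_vertexSet_eq_univ (k n : ℕ) (p : unitInterval) :
    ∀ᵐ H ∂random k n p, H.vertexSet = Set.univ := by
  rw [random, ae_map_iff (measurable_ofEdgeSet n).aemeasurable MeasurableSet.of_discrete]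
  exact Eventually.of_forall fun _ => rfl

end Hypergraph

theorem corollary1p4 (k : ℕ) (hk : 3 ≤ k) (α : ℝ) (hα : 0 < α) (p : ℕ → unitInterval)
    (hp : Tendsto (fun n : ℕ => (p n : ℝ) * (n : ℝ) ^ (k - 1)) atTop atTop) :
    Tendsto
      (fun n : ℕ => Hypergraph.random k n (p n)
        {H | (1 - α) * (n : ℝ) ≤ (H.mc k : ℝ) ∧
          ((k : ℝ) / ((k : ℝ) + 1) - α) * (n : ℝ) ≤ (H.mc (k + 1) : ℝ)})
      atTop (𝓝 1) := by
  obtain ⟨γ₁, hγ₁, n₁, h₁⟩ := Hypergraph.exists_le_mc_self (k := k) (by omega) hα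
  obtain ⟨γ₂, hγ₂, n₂, h₂⟩ := Hypergraph.exists_le_mc_succ hk hα
  have hlim := Hypergraph.tendsto_random_hasTransversalEdges (by omega) (lt_min hγ₁ hγ₂) p hp
  refine tendsto_of_tendsto_of_tendsto_of_le_of_le' hlim tendsto_const_nhds ?_
    (Eventually.of_forall fun n => prob_le_one)
  filter_upwards [eventually_ge_atTop n₁, eventually_ge_atTop n₂] with n hn₁ hn₂
  refine measure_mono_ae ?_
  filter_upwards [Hypergraph.ae_vertexSet_eq_univ k n (p n)] with H hV hH
  exact ⟨h₁ n hn₁ H hV (hH.mono (min_le_left _ _)), h₂ n hn₂ H hV (hH.mono (min_le_right _ _))⟩
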